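/- Let $f=\sum_{\sigma\in\mathfrak S_3}a_\sigma\,x_{\sigma(1)}x_{\sigma(2)}x_{\sigma(3)}\in\mathbb C\langle x_1,x_2,x_3\rangle$ be a complex multilinear noncommutative polynomial of degree three ($f=0$ is allowed), and write $a_{pqr}$ for the coefficient of $x_px_qx_r$. Put $$\alpha=a_{123}+a_{231}+a_{312},\qquad \beta=a_{132}+a_{213}+a_{321}.$$ Let $d$ be a positive integer that is even, or odd with $d<17$. Then the image $\{f(X_1,X_2,X_3): X_1,X_2,X_3\in M_d(\mathbb C)\}$ of $f$ is a vector subspace $V$ of $M_d(\mathbb C)$, and $V$ is one of $\{0\}$, the space of traceless matrices, and $M_d(\mathbb C)$. More precisely: (a) If $d\ge 2$, then $V=\{0\}$ if and only if $f=0$; $V$ is the space of traceless matrices if and only if $f\neq0$ and $\alpha=\beta=0$; and $V=M_d(\mathbb C)$ if and only if $\alpha\neq0$ or $\beta\neq0$. (b) If $d=1$, then $V=\{0\}$ if $\alpha+\beta=0$, and $V=M_1(\mathbb C)=\mathbb C$ otherwise. -/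

import Mathlib

noncomputable section

namespace KaplanskyLvov

/-- Noncommutative polynomials with complex coefficients in `n` freely noncommuting variables. -/
abbrev NCPoly (n : ℕ) : Type := FreeAlgebra ℂ (Fin n)

/-- The coefficient of a word in a noncommutative polynomial. -/
def wordCoeff {n : ℕ} (f : NCPoly n) (w : List (Fin n)) : ℂ :=
  (FreeAlgebra.equivMonoidAlgebraFreeMonoid f).coeff (FreeMonoid.ofList w)

/-- `f ∈ ℂ⟨x₁, …, xₙ⟩` is multilinear, i.e. linear in each of the variables `x₁, …, xₙ`:
every word that occurs in `f` contains each variable exactly once.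
A multilinear polynomial in `n` variables is thus either zero or of degree `n`. -/
def IsMultilinear {n : ℕ} (f : NCPoly n) : Prop :=
  ∀ w : List (Fin n), wordCoeff f w ≠ 0 → ∀ i : Fin n, w.count i = 1

/-- The value of `f` at a tuple `X` of `d × d` matrices. -/
def eval {n d : ℕ} (f : NCPoly n) (X : Fin n → Matrix (Fin d) (Fin d) ℂ) :
    Matrix (Fin d) (Fin d) ℂ :=
  FreeAlgebra.lift ℂ X f

/-- The image of `f` on `n`-tuples of complex `d × d` matrices. -/
def image {n : ℕ} (f : NCPoly n) (d : ℕ) : Set (Matrix (Fin d) (Fin d) ℂ) :=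
  Set.range fun X : Fin n → Matrix (Fin d) (Fin d) ℂ => eval f X

/-- The subspace of traceless `d × d` matrices. -/
def traceless (d : ℕ) : Submodule ℂ (Matrix (Fin d) (Fin d) ℂ) :=
  LinearMap.ker (Matrix.traceLinearMap (Fin d) ℂ ℂ)

/-- `a₁₂₃ + a₂₃₁ + a₃₁₂`, where `a_{pqr}` is the coefficient of `x_p x_q x_r` in `f`
(the variables are numbered from `0` in the code). -/
def evenSum (f : NCPoly 3) : ℂ :=
  wordCoeff f [0, 1, 2] + wordCoeff f [1, 2, 0] + wordCoeff f [2, 0, 1]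

/-- `a₁₃₂ + a₂₁₃ + a₃₂₁`, where `a_{pqr}` is the coefficient of `x_p x_q x_r` in `f`
(the variables are numbered from `0` in the code). -/
def oddSum (f : NCPoly 3) : ℂ :=
  wordCoeff f [0, 2, 1] + wordCoeff f [1, 0, 2] + wordCoeff f [2, 1, 0]

end KaplanskyLvov

end

namespace KaplanskyLvov

open Matrix

variable {n : Type*} [Fintype n] [DecidableEq n]

/-! Taking traces gives `tr f = α tr(XYZ) + β tr(XZY)`, so `α = β = 0` forces traceless values. If
`α + β ≠ 0`, then `f(1, 1, Z) = (α + β) Z` reaches everything.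

In the other cases `α + β = 0`. For diagonal `X` and `Y`, `f(X, Y, ·)` multiplies each entry of `Z`
by a scalar, generically nonzero off the diagonal. Hence every zero-diagonal matrix is a value
(`exists_triForm_diagonal_eq` with `κ = 0`), and Fillmore's theorem `exists_isConj_diag_eq` carries
this to nonscalar traceless matrices. When `α ≠ 0`, one extra off-diagonal entry `κ` in `Y` produces
two diagonal entries with any prescribed sum, so nonscalar matrices of any trace are reached. Scalar
matrices then come from clock and shift matrices (`exists_triForm_eq_scalar`). -/

/-- The value at `(X, Y, Z)` of the multilinear polynomial with coefficients
`a₁₂₃, a₁₃₂, a₂₁₃, a₂₃₁, a₃₁₂, a₃₂₁`. -/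
def triForm (a b c d e g : ℂ) (X Y Z : Matrix n n ℂ) : Matrix n n ℂ :=
  a • (X * Y * Z) + b • (X * Z * Y) + c • (Y * X * Z) + d • (Y * Z * X) + e • (Z * X * Y) +
    g • (Z * Y * X)

/-! ### Symmetry, trace and similarity invariance -/

omit [DecidableEq n] in
theorem triForm_swap (a b c d e g : ℂ) (X Y Z : Matrix n n ℂ) :
    triForm a b c d e g X Y Z = triForm b a e g c d X Z Y := by
  simp only [triForm]; abel

omit [DecidableEq n] in
theorem trace_triForm (a b c d e g : ℂ) (X Y Z : Matrix n n ℂ) :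
    (triForm a b c d e g X Y Z).trace =
      (a + d + e) * (X * Y * Z).trace + (b + c + g) * (X * Z * Y).trace := by
  have h1 : (Y * Z * X).trace = (X * Y * Z).trace := by
    rw [trace_mul_comm, ← Matrix.mul_assoc]
  have h2 : (Z * X * Y).trace = (X * Y * Z).trace := by
    rw [Matrix.mul_assoc, trace_mul_comm]
  have h3 : (Y * X * Z).trace = (X * Z * Y).trace := by
    rw [Matrix.mul_assoc, trace_mul_comm]
  have h4 : (Z * Y * X).trace = (X * Z * Y).trace := by
    rw [trace_mul_comm, ← Matrix.mul_assoc]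
  simp only [triForm, trace_add, trace_smul, h1, h2, h3, h4, smul_eq_mul]
  ring

theorem exists_eq_of_isConj {A B : Matrix n n ℂ} (h : IsConj A B) :
    ∃ P Q : Matrix n n ℂ, P * Q = 1 ∧ Q * P = 1 ∧ B = P * A * Q := by
  obtain ⟨P, hP⟩ := h
  exact ⟨P.val, P.inv, P.val_inv, P.inv_val, by rw [hP.eq, mul_assoc, P.val_inv, mul_one]⟩

/-- The set of values of `triForm` is invariant under conjugation. -/
theorem exists_triForm_eq_of_isConj {a b c d e g : ℂ} {A B : Matrix n n ℂ} (h : IsConj A B)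
    (hB : ∃ X Y Z, triForm a b c d e g X Y Z = B) : ∃ X Y Z, triForm a b c d e g X Y Z = A := by
  obtain ⟨P, Q, -, hQP, rfl⟩ := exists_eq_of_isConj h.symm
  obtain ⟨X, Y, Z, rfl⟩ := hB
  have hc : ∀ M : Matrix n n ℂ, Q * (P * M) = M := fun M => by rw [← mul_assoc, hQP, one_mul]
  exact ⟨P * X * Q, P * Y * Q, P * Z * Q, by simp [triForm, mul_add, add_mul, mul_assoc, hc]⟩

theorem trace_eq_of_isConj {A B : Matrix n n ℂ} (h : IsConj A B) : A.trace = B.trace := by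
  obtain ⟨P, Q, -, hQP, rfl⟩ := exists_eq_of_isConj h
  rw [trace_mul_comm, ← mul_assoc, hQP, one_mul]

/-! ### Solving for `Z` with `X` and `Y` almost diagonal -/

theorem diagonal_add_single_mul_apply (δ : n → ℂ) (κ : ℂ) (u v : n) (M : Matrix n n ℂ) (i j : n) :
    ((diagonal δ + single u v κ) * M) i j = δ i * M i j + if i = u then κ * M v j else 0 := by
  rw [add_mul, Matrix.add_apply, diagonal_mul]
  split_ifs with h
  · subst h; simp
  · rw [single_mul_apply_of_ne _ _ _ _ _ h]

theorem mul_diagonal_add_single_apply (δ : n → ℂ) (κ : ℂ) (u v : n) (M : Matrix n n ℂ) (i j : n) :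
    (M * (diagonal δ + single u v κ)) i j = M i j * δ j + if j = v then M i u * κ else 0 := by
  rw [mul_add, Matrix.add_apply, mul_diagonal]
  split_ifs with h
  · subst h; simp
  · rw [mul_single_apply_of_ne (hbj := h)]

/-- The system for `Z` is diagonal up to the `κ` terms, which affect only row `u` and column `v` and
read only row `v` and column `u` of `Z`. -/
theorem triForm_diagonal_apply (a b c d e g : ℂ) (l δ : n → ℂ) (κ : ℂ) (u v : n)
    (Z : Matrix n n ℂ) (i j : n) :
    triForm a b c d e g (diagonal l) (diagonal δ + single u v κ) Z i j =
      ((a + c) * l i * δ i + b * l i * δ j + d * l j * δ i + (e + g) * l j * δ j) * Z i j +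
      (if i = u then κ * (a * l u + c * l v + d * l j) * Z v j else 0) +
      (if j = v then κ * (b * l i + e * l u + g * l v) * Z i u else 0) := by
  simp only [triForm, mul_assoc (diagonal l)]
  rw [mul_assoc (diagonal δ + single u v κ) (diagonal l) Z]
  rw [mul_assoc Z (diagonal δ + single u v κ) (diagonal l), ← mul_assoc Z]
  simp only [Matrix.add_apply, Matrix.smul_apply, smul_eq_mul, diagonal_mul, mul_diagonal,
    diagonal_add_single_mul_apply, mul_diagonal_add_single_apply]
  by_cases hi : i = u <;> by_cases hj : j = v <;> simp [hi, hj] <;> ring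

/-- With `X` diagonal and `Y` diagonal up to a single entry, the equation `f(X, Y, Z) = A` can be
solved for `Z` as soon as two diagonal entries of `A` have the right values. -/
theorem exists_triForm_diagonal_eq (a b c d e g : ℂ) (l δ : n → ℂ) (κ : ℂ) {u v : n} (huv : u ≠ v)
    (q : n → n → ℂ) (hq : ∀ i j, q i j =
      (a + c) * l i * δ i + b * l i * δ j + d * l j * δ i + (e + g) * l j * δ j)
    (hq0 : ∀ i j, i ≠ j → q i j ≠ 0) (A : Matrix n n ℂ)
    (hA : ∀ i, i ≠ u → i ≠ v → A i i = 0)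
    (hu : A u u = κ * ((a + d) * l u + c * l v) * (A v u / q v u))
    (hv : A v v = κ * (e * l u + (b + g) * l v) * (A v u / q v u)) :
    ∃ Z, triForm a b c d e g (diagonal l) (diagonal δ + single u v κ) Z = A := by
  let B : Matrix n n ℂ := fun i j => if i = j then 0 else A i j / q i j
  let Z : Matrix n n ℂ := fun i j => if i = j then 0 else
    (A i j - (if i = u then κ * (a * l u + c * l v + d * l j) * B v j else 0) -
      (if j = v then κ * (b * l i + e * l u + g * l v) * B i u else 0)) / q i j
  -- The corrections read `Z` only where they themselves vanish (off the diagonal, where `Z` is set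
  -- to zero), so the definition of `Z` through `B` is not circular.
  have hZv : ∀ j, Z v j = B v j := by
    intro j
    by_cases hj : v = j
    · simp [Z, B, hj]
    · simp [Z, B, hj, huv.symm, Ne.symm hj]
  have hZu : ∀ i, Z i u = B i u := by
    intro i
    by_cases hi : i = u
    · simp [Z, B, hi]
    · simp [Z, B, hi, huv]
  refine ⟨Z, ?_⟩
  ext i j
  rw [triForm_diagonal_apply, hZv, hZu, ← hq]
  by_cases hij : i = j
  · subst hij
    have h0 : Z i i = 0 := by simp [Z]
    rw [h0]
    by_cases h1 : i = u
    · subst h1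
      have : B v i = A v i / q v i := by simp [B, huv.symm]
      simp only [if_true, huv, if_false, this, hu]; ring
    · by_cases h2 : i = v
      · subst h2
        have : B i u = A i u / q i u := by simp [B, h1]
        simp only [if_true, h1, if_false, this, hv]; ring
      · simp [h1, h2, hA i h1 h2]
  · have hZ : q i j * Z i j = A i j -
        (if i = u then κ * (a * l u + c * l v + d * l j) * B v j else 0) -
        (if j = v then κ * (b * l i + e * l u + g * l v) * B i u else 0) := by
      have := hq0 i j hij
      simp only [Z, hij, if_false]
      field_simp
    rw [hZ]; ring

/-- Generic diagonal matrices. -/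
theorem exists_generic_diagonal (k : ℕ) {e₁ e₂ e₃ e₄ : ℂ}
    (he : ¬ (e₁ = 0 ∧ e₂ = 0 ∧ e₃ = 0 ∧ e₄ = 0)) :
    ∃ l δ : Fin k → ℂ, ∀ i j, i ≠ j → l i ≠ l j ∧
      e₁ * l i * δ i + e₂ * l i * δ j + e₃ * l j * δ i + e₄ * l j * δ j ≠ 0 := by
  open Polynomial in
  let R : Fin k → Fin k → ℂ[X] := fun i j => (X ^ (i : ℕ) - X ^ (j : ℕ)) *
    (C e₁ * X ^ (i : ℕ) * X ^ (2 * i : ℕ) + C e₂ * X ^ (i : ℕ) * X ^ (2 * j : ℕ) +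
      C e₃ * X ^ (j : ℕ) * X ^ (2 * i : ℕ) + C e₄ * X ^ (j : ℕ) * X ^ (2 * j : ℕ))
  -- With `l i = t ^ i` and `δ i = t ^ (2 * i)`, the exponents `3i`, `i + 2j`, `j + 2i`, `3j` are
  -- distinct for `i ≠ j`, so no cancellation occurs between the four terms.
  have hR : ∀ i j, i ≠ j → R i j ≠ 0 := by
    intro i j hij
    have hij' : (i : ℕ) ≠ j := fun h => hij (Fin.ext h)
    refine mul_ne_zero ?_ ?_
    · intro h
      have := congrArg (fun p => Polynomial.coeff p (i : ℕ)) h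
      simp [Polynomial.coeff_X_pow, hij'] at this
    · intro h
      apply he
      simp only [mul_assoc, ← pow_add] at h
      refine ⟨?_, ?_, ?_, ?_⟩
      · have := congrArg (fun p => Polynomial.coeff p (i + 2 * i : ℕ)) h
        simpa [Polynomial.coeff_X_pow, hij', hij'.symm, show ¬ (i + 2 * i : ℕ) = i + 2 * j by omega,
          show ¬ (i + 2 * i : ℕ) = j + 2 * i by omega,
          show ¬ (i + 2 * i : ℕ) = j + 2 * j by omega] using this
      · have := congrArg (fun p => Polynomial.coeff p (i + 2 * j : ℕ)) h
        simpa [Polynomial.coeff_X_pow, hij', hij'.symm, show ¬ (i + 2 * j : ℕ) = i + 2 * i by omega,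
          show ¬ (i + 2 * j : ℕ) = j + 2 * i by omega,
          show ¬ (i + 2 * j : ℕ) = j + 2 * j by omega] using this
      · have := congrArg (fun p => Polynomial.coeff p (j + 2 * i : ℕ)) h
        simpa [Polynomial.coeff_X_pow, hij', hij'.symm, show ¬ (j + 2 * i : ℕ) = i + 2 * i by omega,
          show ¬ (j + 2 * i : ℕ) = i + 2 * j by omega,
          show ¬ (j + 2 * i : ℕ) = j + 2 * j by omega] using this
      · have := congrArg (fun p => Polynomial.coeff p (j + 2 * j : ℕ)) h
        simpa [Polynomial.coeff_X_pow, hij', hij'.symm, show ¬ (j + 2 * j : ℕ) = i + 2 * i by omega,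
          show ¬ (j + 2 * j : ℕ) = i + 2 * j by omega,
          show ¬ (j + 2 * j : ℕ) = j + 2 * i by omega] using this
  have hprod : ∏ i, ∏ j, (if i = j then 1 else R i j) ≠ 0 := by
    refine Finset.prod_ne_zero_iff.2 fun i _ => Finset.prod_ne_zero_iff.2 fun j _ => ?_
    split_ifs with h
    · exact one_ne_zero
    · exact hR i j h
  obtain ⟨t, ht⟩ : ∃ t, (∏ i, ∏ j, (if i = j then 1 else R i j)).eval t ≠ 0 := by
    by_contra! h
    exact hprod (Polynomial.funext fun t => by simpa using h t)
  refine ⟨fun i => t ^ (i : ℕ), fun i => t ^ (2 * i : ℕ), fun i j hij => ?_⟩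
  simp only [Polynomial.eval_prod] at ht
  have h := Finset.prod_ne_zero_iff.1 (Finset.prod_ne_zero_iff.1 ht i (Finset.mem_univ _)) j
    (Finset.mem_univ _)
  rw [if_neg hij] at h
  simp only [R, Polynomial.eval_mul, Polynomial.eval_sub, Polynomial.eval_add, Polynomial.eval_pow,
    Polynomial.eval_X, Polynomial.eval_C] at h
  exact ⟨sub_ne_zero.1 (left_ne_zero_of_mul h), right_ne_zero_of_mul h⟩

/-! ### Similarity and prescribed diagonals -/

theorem isConj_mul_mul (A : Matrix n n ℂ) {P Q : Matrix n n ℂ} (h : P * Q = 1) :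
    IsConj A (P * A * Q) := by
  have h' : Q * P = 1 := mul_eq_one_comm.1 h
  refine ⟨⟨P, Q, h, h'⟩, ?_⟩
  change P * A = P * A * Q * P
  rw [mul_assoc (P * A), h', mul_one]

theorem isConj_transvection (A : Matrix n n ℂ) {i j : n} (hij : i ≠ j) (z : ℂ) :
    IsConj A (transvection i j (-z) * A * transvection i j z) :=
  isConj_mul_mul A (by rw [transvection_mul_transvection_same _ _ hij, neg_add_cancel,
    transvection_zero])

theorem isConj_submatrix (A : Matrix n n ℂ) (σ : Equiv.Perm n) : IsConj A (A.submatrix σ σ) := by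
  have h := isConj_mul_mul A (P := σ.toPEquiv.toMatrix) (Q := σ.symm.toPEquiv.toMatrix) (by
    rw [← PEquiv.toMatrix_trans, ← Equiv.toPEquiv_trans]; simp)
  rwa [PEquiv.toMatrix_toPEquiv_mul, PEquiv.mul_toMatrix_toPEquiv, submatrix_submatrix] at h

omit [Fintype n] in
theorem exists_perm_apply_apply {i j u v : n} (hij : i ≠ j) (huv : u ≠ v) :
    ∃ σ : Equiv.Perm n, σ u = i ∧ σ v = j := by
  have h1 : Equiv.swap u i j ≠ u := by
    intro h
    apply hij
    rw [← Equiv.swap_apply_left u i] at h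
    nth_rw 3 [← Equiv.swap_apply_right u i] at h
    simpa using ((Equiv.swap_apply_eq_iff.1 h).symm)
  refine ⟨Equiv.swap u i * Equiv.swap v (Equiv.swap u i j), ?_, ?_⟩
  · simp [Equiv.swap_apply_of_ne_of_ne huv h1.symm]
  · simp

/-- A nonscalar matrix is similar to one with a prescribed off-diagonal entry nonzero. -/
theorem exists_isConj_apply_ne_zero (A : Matrix n n ℂ) (hA : ∀ c : ℂ, A ≠ scalar n c) {u v : n}
    (huv : u ≠ v) : ∃ B, IsConj A B ∧ B u v ≠ 0 := by
  have key : ∀ A : Matrix n n ℂ, (∃ i j, i ≠ j ∧ A i j ≠ 0) → ∃ B, IsConj A B ∧ B u v ≠ 0 := by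
    rintro A ⟨i, j, hij, h⟩
    obtain ⟨σ, rfl, rfl⟩ := exists_perm_apply_apply hij huv
    exact ⟨_, isConj_submatrix A σ, h⟩
  by_cases h : ∃ i j, i ≠ j ∧ A i j ≠ 0
  · exact key A h
  push Not at h
  obtain ⟨i, hi⟩ : ∃ i, A i i ≠ A u u := by
    by_contra! h'
    refine hA (A u u) ?_
    ext i j
    by_cases hij : i = j
    · subst hij; simp [h' i]
    · simp [h i j hij, hij]
  have hiu : i ≠ u := fun h' => hi (by rw [h'])
  -- For diagonal `A` this transvection creates the `(i, u)` entry `A i i - A u u`.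
  obtain ⟨B, hB, hB'⟩ := key _ ⟨i, u, hiu, show (transvection i u (-1) * A * transvection i u (1 : ℂ) : Matrix n n ℂ) i u
    ≠ 0 by simpa [h i u hiu, h u i hiu.symm, ← sub_eq_add_neg, sub_eq_zero, add_comm] using hi⟩
  exact ⟨B, (isConj_transvection A hiu 1).trans hB, hB'⟩

theorem exists_isConj_apply_self_eq (A : Matrix n n ℂ) {u v : n} (huv : u ≠ v) (hA : A v u ≠ 0)
    (x : ℂ) : ∃ B, IsConj A B ∧ B u u = x ∧ B v u ≠ 0 := by
  refine ⟨_, isConj_transvection A huv ((A u u - x) / A v u), ?_, ?_⟩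
  · rw [mul_transvection_apply_of_ne (hb := huv), transvection_mul_apply_same]
    field_simp; ring
  · rwa [mul_transvection_apply_of_ne (hb := huv), transvection_mul_apply_of_ne (ha := huv.symm)]

/-- The block diagonal matrix with blocks `1` and `P`. -/
def consBlock {k : ℕ} (P : Matrix (Fin k) (Fin k) ℂ) : Matrix (Fin (k + 1)) (Fin (k + 1)) ℂ :=
  Matrix.of (Fin.cons (Fin.cons 1 0) fun i => Fin.cons 0 (P i))

theorem consBlock_mul {k : ℕ} (P Q : Matrix (Fin k) (Fin k) ℂ) :
    consBlock P * consBlock Q = consBlock (P * Q) := by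
  ext i j
  refine Fin.cases ?_ (fun i => ?_) i <;> refine Fin.cases ?_ (fun j => ?_) j <;>
    simp [consBlock, mul_apply, Fin.sum_univ_succ]

theorem consBlock_one {k : ℕ} : consBlock (1 : Matrix (Fin k) (Fin k) ℂ) = 1 := by
  ext i j
  refine Fin.cases ?_ (fun i => ?_) i <;> refine Fin.cases ?_ (fun j => ?_) j <;>
    simp [consBlock, one_apply, Fin.succ_ne_zero, (Fin.succ_ne_zero _).symm]

/-- A similarity of the lower right block extends to the whole matrix. -/
theorem exists_isConj_of_isConj_submatrix {k : ℕ} (A : Matrix (Fin (k + 1)) (Fin (k + 1)) ℂ)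
    {B : Matrix (Fin k) (Fin k) ℂ} (h : IsConj (A.submatrix Fin.succ Fin.succ) B) :
    ∃ A', IsConj A A' ∧ A' 0 0 = A 0 0 ∧ A'.submatrix Fin.succ Fin.succ = B := by
  obtain ⟨P, Q, hPQ, -, hB⟩ := exists_eq_of_isConj h
  refine ⟨_, isConj_mul_mul A (P := consBlock P) (Q := consBlock Q)
    (by rw [consBlock_mul, hPQ, consBlock_one]), ?_, ?_⟩
  · simp [consBlock, mul_apply, Fin.sum_univ_succ]
  · rw [hB]
    ext i j
    simp [consBlock, mul_apply, Fin.sum_univ_succ]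

/-- Fillmore's theorem: a nonscalar matrix is similar to one with any prescribed diagonal of the
right sum, here together with a nonzero entry left of the last diagonal entry. -/
theorem exists_isConj_diag_eq {k : ℕ} (A : Matrix (Fin (k + 2)) (Fin (k + 2)) ℂ)
    (hA : ∀ c : ℂ, A ≠ scalar _ c) (δ : Fin (k + 2) → ℂ) (hδ : ∑ i, δ i = A.trace) :
    ∃ B, IsConj A B ∧ (∀ i, B i i = δ i) ∧ B (Fin.last (k + 1)) (Fin.last k).castSucc ≠ 0 := by
  induction k with
  | zero =>
    obtain ⟨A₁, h₁, h₁'⟩ := exists_isConj_apply_ne_zero A hA (u := 1) (v := 0) (by simp)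
    obtain ⟨B, h₂, h₂', h₂''⟩ := exists_isConj_apply_self_eq A₁ (u := 0) (v := 1) (by simp) h₁' (δ 0)
    refine ⟨B, h₁.trans h₂, ?_, h₂''⟩
    rw [trace_eq_of_isConj (h₁.trans h₂), trace, Fin.sum_univ_two, Fin.sum_univ_two, diag_apply, diag_apply,
      h₂'] at hδ
    intro i
    fin_cases i
    · exact h₂'
    · exact (add_left_cancel hδ).symm
  | succ k ih =>
    have h01 : (0 : Fin (k + 3)) ≠ 1 := by simp
    have h02 : (0 : Fin (k + 3)) ≠ 2 := Fin.ne_of_val_ne (by simp [Nat.mod_eq_of_lt])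
    have h12 : (1 : Fin (k + 3)) ≠ 2 := Fin.ne_of_val_ne (by simp [Nat.mod_eq_of_lt])
    obtain ⟨A₁, h₁, h₁'⟩ := exists_isConj_apply_ne_zero A hA h01.symm
    obtain ⟨A₂, h₂, h₂', h₂''⟩ := exists_isConj_apply_self_eq A₁ h01 h₁' (δ 0)
    obtain ⟨A₃, h₃, h₃', h₃''⟩ : ∃ A₃, IsConj A₂ A₃ ∧ A₃ 0 0 = δ 0 ∧
        ∀ c : ℂ, A₃.submatrix Fin.succ Fin.succ ≠ scalar _ c := by
      by_cases hs : ∀ c : ℂ, A₂.submatrix Fin.succ Fin.succ ≠ scalar _ c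
      · exact ⟨A₂, IsConj.refl _, h₂', hs⟩
      push Not at hs
      obtain ⟨c, hc⟩ := hs
      have hA12 : A₂ 1 2 = 0 := by
        have := congrFun (congrFun hc 0) 1
        simpa using this
      -- The two parameters make the changes of the `(0, 0)` entry cancel, while the `(1, 2)` entry
      -- becomes `-(A₂ 1 0) ^ 2 ≠ 0`, so the lower block is no longer scalar.
      refine ⟨_, (isConj_transvection A₂ h01 (A₂ 2 0)).trans
        (isConj_transvection _ h02 (-A₂ 1 0)), ?_, ?_⟩
      · simp [h01, h02, h02.symm, h₂']
        ring
      · intro c' hc'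
        have := congrFun (congrFun hc' 0) 1
        simp [h01, h01.symm, h12.symm, hA12, h₂''] at this
    have hsum : ∑ i, δ (Fin.succ i) = (A₃.submatrix Fin.succ Fin.succ).trace := by
      rw [trace_eq_of_isConj ((h₁.trans h₂).trans h₃), trace, Fin.sum_univ_succ, Fin.sum_univ_succ (n := k + 2),
        diag_apply, h₃'] at hδ
      exact add_left_cancel hδ
    obtain ⟨B', hB, hBd, hBl⟩ := ih _ h₃'' (fun i => δ i.succ) hsum
    obtain ⟨B, h₄, h₄', h₄''⟩ := exists_isConj_of_isConj_submatrix A₃ hB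
    refine ⟨B, ((h₁.trans h₂).trans h₃).trans h₄, ?_, ?_⟩
    · refine Fin.cases (h₄'.trans h₃') fun i => ?_
      rw [← hBd i, ← h₄'', submatrix_apply]
    · rwa [← h₄'', submatrix_apply, Fin.succ_last, Fin.succ_castSucc, Fin.succ_last] at hBl

/-! ### Matrices that are values of the form -/

theorem exists_triForm_eq_of_generic {k : ℕ} {a b c d e g : ℂ}
    (hgen : ¬ (a + c = 0 ∧ b = 0 ∧ d = 0 ∧ e + g = 0)) (A : Matrix (Fin (k + 2)) (Fin (k + 2)) ℂ)
    (hA : ∀ x : ℂ, A ≠ scalar _ x)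
    (ht : A.trace = 0 ∨ (a + d + e ≠ 0 ∧ (a + d + e) + (b + c + g) = 0)) :
    ∃ X Y Z, triForm a b c d e g X Y Z = A := by
  obtain ⟨l, δ, hlδ⟩ := exists_generic_diagonal (k + 2) hgen
  obtain ⟨u, hu⟩ : ∃ u, u = (Fin.last k).castSucc := ⟨_, rfl⟩
  obtain ⟨v, hv⟩ : ∃ v, v = Fin.last (k + 1) := ⟨_, rfl⟩
  have huv : u ≠ v := by rw [hu, hv]; exact (Fin.castSucc_lt_last _).ne
  have hq0 := fun i j hij => (hlδ i j hij).2
  rcases ht with ht | ⟨hα, hαβ⟩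
  · obtain ⟨B, hAB, hB, -⟩ := exists_isConj_diag_eq A hA 0 (by simp [ht])
    obtain ⟨Z, hZ⟩ := exists_triForm_diagonal_eq a b c d e g l δ 0 huv _ (fun _ _ => rfl) hq0 B
      (fun i _ _ => hB i) (by simp [hB]) (by simp [hB])
    exact exists_triForm_eq_of_isConj hAB ⟨_, _, Z, hZ⟩
  · have hl : l u - l v ≠ 0 := sub_ne_zero.2 (hlδ u v huv).1
    set t := A.trace
    -- Since `α + β = 0`, the two diagonal entries sum to `w * α * (l u - l v)`, which must equal
    -- the trace.
    set w := t / ((a + d + e) * (l u - l v)) with hw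
    have hsum : w * ((a + d) * l u + c * l v) + w * (e * l u + (b + g) * l v) = t := by
      have : w * ((a + d + e) * (l u - l v)) = t := by rw [hw]; field_simp
      rw [← this, eq_neg_of_add_eq_zero_left hαβ]
      linear_combination w * l u * hαβ
    obtain ⟨B, hAB, hB, hBl⟩ := exists_isConj_diag_eq A hA
      (Pi.single u (w * ((a + d) * l u + c * l v)) + Pi.single v (w * (e * l u + (b + g) * l v)))
      (by simp [Finset.sum_add_distrib, hsum, t])
    rw [← hu, ← hv] at hBl
    have hq := div_mul_div_cancel₀' (hq0 v u huv.symm) (B v u) (B v u)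
    rw [div_self hBl, mul_comm] at hq
    -- `κ` is chosen so that `κ * (B v u / q v u) = w`; this needs the nonzero entry `B v u`
    -- supplied by Fillmore's theorem.
    obtain ⟨Z, hZ⟩ := exists_triForm_diagonal_eq a b c d e g l δ
      (w * (((a + c) * l v * δ v + b * l v * δ u + d * l u * δ v + (e + g) * l u * δ u) / B v u))
      huv _ (fun _ _ => rfl) hq0 B (fun i hi hi' => by simp [hB, hi, hi'])
      (by rw [hB]; simp only [Pi.add_apply, Pi.single_eq_same, Pi.single_eq_of_ne huv]
          linear_combination -(w * ((a + d) * l u + c * l v)) * hq)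
      (by rw [hB]; simp only [Pi.add_apply, Pi.single_eq_same, Pi.single_eq_of_ne huv.symm]
          linear_combination -(w * (e * l u + (b + g) * l v)) * hq)
    exact exists_triForm_eq_of_isConj hAB ⟨_, _, Z, hZ⟩

/-- The generic argument fails only if its four coefficients vanish. Exchanging `Y` and `Z` gives
four others, and all eight vanish only for the zero form. -/
theorem exists_triForm_eq_of_nonscalar {k : ℕ} {a b c d e g : ℂ}
    (h0 : ¬ (a = 0 ∧ b = 0 ∧ c = 0 ∧ d = 0 ∧ e = 0 ∧ g = 0))
    (A : Matrix (Fin (k + 2)) (Fin (k + 2)) ℂ) (hA : ∀ x : ℂ, A ≠ scalar _ x)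
    (ht : A.trace = 0 ∨ (a + d + e ≠ 0 ∧ (a + d + e) + (b + c + g) = 0)) :
    ∃ X Y Z, triForm a b c d e g X Y Z = A := by
  by_cases h1 : a + c = 0 ∧ b = 0 ∧ d = 0 ∧ e + g = 0
  · by_cases h2 : b + e = 0 ∧ a = 0 ∧ g = 0 ∧ c + d = 0
    · exfalso
      obtain ⟨h1, rfl, rfl, h1'⟩ := h1
      obtain ⟨h2, rfl, rfl, h2'⟩ := h2
      exact h0 ⟨rfl, rfl, by simpa using h1, rfl, by simpa using h1', rfl⟩
    · have ht' : A.trace = 0 ∨ (b + g + c ≠ 0 ∧ (b + g + c) + (a + e + d) = 0) := by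
        refine ht.imp_right fun ⟨h, h'⟩ => ⟨fun h'' => h ?_, by linear_combination h'⟩
        linear_combination h' - h''
      obtain ⟨X, Z, Y, h⟩ := exists_triForm_eq_of_generic h2 A hA ht'
      exact ⟨X, Y, Z, (triForm_swap ..).trans h⟩
  · exact exists_triForm_eq_of_generic h1 A hA ht

/-- Sylvester's clock and shift matrices show that scalar matrices are values. -/
theorem exists_triForm_eq_scalar {k : ℕ} {a b c d e g : ℂ} (hα : a + d + e ≠ 0)
    (hαβ : (a + d + e) + (b + c + g) = 0) (x : ℂ) :
    ∃ X Y Z : Matrix (Fin (k + 2)) (Fin (k + 2)) ℂ, triForm a b c d e g X Y Z = scalar _ x := by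
  obtain ⟨ω, hω⟩ : ∃ ω : ℂ, IsPrimitiveRoot ω (k + 2) :=
    ⟨_, Complex.isPrimitiveRoot_exp (k + 2) (by omega)⟩
  have hω0 : ω ≠ 0 := hω.ne_zero (by omega)
  have hω1 : ω ≠ 1 := hω.ne_one (by omega)
  let X : Matrix (Fin (k + 2)) (Fin (k + 2)) ℂ := diagonal fun i => ω ^ (i : ℕ)
  let X' : Matrix (Fin (k + 2)) (Fin (k + 2)) ℂ := diagonal fun i => (ω ^ (i : ℕ))⁻¹
  let Y : Matrix (Fin (k + 2)) (Fin (k + 2)) ℂ := (Equiv.addRight 1).toPEquiv.toMatrix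
  let Y' : Matrix (Fin (k + 2)) (Fin (k + 2)) ℂ := (Equiv.addRight 1).symm.toPEquiv.toMatrix
  have hX : X * X' = 1 := by
    simp [X, X', diagonal_mul_diagonal, hω0]
  have hY : Y * Y' = 1 := by
    rw [← PEquiv.toMatrix_trans, ← Equiv.toPEquiv_trans, Equiv.self_trans_symm,
      Equiv.toPEquiv_refl, PEquiv.toMatrix_refl]
  have hX' : X' * X = 1 := mul_eq_one_comm.1 hX
  have hY' : Y' * Y = 1 := mul_eq_one_comm.1 hY
  have hYX : Y * X = ω • (X * Y) := by
    ext i j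
    simp only [X, Y, mul_diagonal, diagonal_mul, Matrix.smul_apply, PEquiv.toMatrix_toPEquiv_apply,
      Pi.single_apply, Equiv.coe_addRight, smul_eq_mul]
    split_ifs with h
    · rw [h, one_mul, mul_one, ← pow_succ', Fin.val_add_one]
      split_ifs with h'
      · rw [h']; simp [hω.pow_eq_one]
      · rfl
    · simp
  have e1 : X * Y * (Y' * X') = 1 := by
    rw [mul_assoc, ← mul_assoc Y, hY, one_mul, hX]
  have e2 : Y * (Y' * X') * X = 1 := by
    rw [← mul_assoc Y, hY, one_mul, hX']
  have e3 : Y' * X' * X * Y = 1 := by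
    rw [mul_assoc Y', hX', mul_one, hY']
  have e4 : Y * X * (Y' * X') = ω • 1 := by
    rw [hYX, smul_mul_assoc, e1]
  have e5 : Y' * X' * Y * X = ω • 1 := by
    rw [mul_assoc (Y' * X'), hYX, mul_smul_comm, ← mul_assoc, e3]
  have e6 : X * (Y' * X') * Y = ω • 1 := by
    have h := congrArg (fun M => X * M * X') e5
    simp only [mul_assoc, hX, mul_one, smul_mul_assoc, mul_smul_comm] at h
    simpa only [mul_assoc] using h
  -- As `Z = (XY)⁻¹`, cyclic rotations of `XYZ` give `1` and the other three words give `ω`, so the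
  -- unscaled value is `α + ω β = α (1 - ω)`.
  refine ⟨(x / ((a + d + e) * (1 - ω))) • X, Y, Y' * X', ?_⟩
  have h1ω : 1 - ω ≠ 0 := sub_ne_zero.2 hω1.symm
  simp only [triForm, smul_mul_assoc, mul_smul_comm, e1, e2, e3, e4, e5, e6, smul_smul]
  rw [← add_smul, ← add_smul, ← add_smul, ← add_smul, ← add_smul, ← diagonal_one,
    ← diagonal_smul, scalar_apply]
  congr 1
  ext
  simp only [Pi.smul_apply, smul_eq_mul, mul_one]
  have hβ : b + c + g = -(a + d + e) := eq_neg_of_add_eq_zero_right hαβ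
  field_simp
  linear_combination x * ω * hβ

/-! ### From the free algebra to the six coefficients -/

theorem mem_of_wordCoeff_ne_zero {f : NCPoly 3} (hf : IsMultilinear f) {w : List (Fin 3)}
    (hw : wordCoeff f w ≠ 0) : w ∈ ({[0, 1, 2], [0, 2, 1], [1, 0, 2], [1, 2, 0], [2, 0, 1],
      [2, 1, 0]} : Finset (List (Fin 3))) := by
  have hperm : w.Perm [0, 1, 2] := by
    rw [List.perm_iff_count]
    intro i
    rw [hf w hw]
    fin_cases i <;> rfl
  have hmem := List.mem_permutations.2 hperm
  simp [List.permutations, List.permutationsAux, List.permutationsAux.rec] at hmem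
  simp only [Finset.mem_insert, Finset.mem_singleton]
  tauto

theorem eval_eq_triForm {f : NCPoly 3} (hf : IsMultilinear f) {m : ℕ}
    (X : Fin 3 → Matrix (Fin m) (Fin m) ℂ) :
    eval f X = triForm (wordCoeff f [0, 1, 2]) (wordCoeff f [0, 2, 1]) (wordCoeff f [1, 0, 2])
      (wordCoeff f [1, 2, 0]) (wordCoeff f [2, 0, 1]) (wordCoeff f [2, 1, 0]) (X 0) (X 1) (X 2) := by
  obtain ⟨p, rfl⟩ := FreeAlgebra.equivMonoidAlgebraFreeMonoid.symm.surjective f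
  let S : Finset (List (Fin 3)) :=
    {[0, 1, 2], [0, 2, 1], [1, 0, 2], [1, 2, 0], [2, 0, 1], [2, 1, 0]}
  have hc : ∀ w, wordCoeff (FreeAlgebra.equivMonoidAlgebraFreeMonoid.symm p) w =
      p.coeff (FreeMonoid.ofList w) := by
    intro w; simp [wordCoeff]
  have hsub : p.coeff.support ⊆ S.map FreeMonoid.ofList.toEmbedding := by
    intro w hw
    refine Finset.mem_map.2 ⟨FreeMonoid.toList w, ?_, rfl⟩
    exact mem_of_wordCoeff_ne_zero hf (by rw [hc]; simpa using hw)
  have hp : p = ∑ w ∈ S, MonoidAlgebra.single (FreeMonoid.ofList w)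
      (p.coeff (FreeMonoid.ofList w)) := by
    conv_lhs => rw [← MonoidAlgebra.sum_coeff_single p]
    rw [Finsupp.sum_of_support_subset _ hsub _ (by simp), Finset.sum_map]
    rfl
  have hsingle : ∀ (w : List (Fin 3)) (z : ℂ), FreeAlgebra.lift ℂ X (FreeAlgebra.equivMonoidAlgebraFreeMonoid.symm
      (MonoidAlgebra.single (FreeMonoid.ofList w) z)) = z • (w.map X).prod := by
    intro w z
    simp [FreeAlgebra.equivMonoidAlgebraFreeMonoid, FreeMonoid.lift_apply, map_list_prod,
      Function.comp_def]
  simp only [hc]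
  conv_lhs => rw [hp]
  simp only [eval, map_sum, hsingle]
  simp [S, triForm, mul_assoc, add_assoc]

theorem eq_zero_of_wordCoeff_eq_zero {f : NCPoly 3} (hf : IsMultilinear f)
    (h : wordCoeff f [0, 1, 2] = 0 ∧ wordCoeff f [0, 2, 1] = 0 ∧ wordCoeff f [1, 0, 2] = 0 ∧
      wordCoeff f [1, 2, 0] = 0 ∧ wordCoeff f [2, 0, 1] = 0 ∧ wordCoeff f [2, 1, 0] = 0) :
    f = 0 := by
  have h0 : ∀ w, wordCoeff f w = 0 := by
    intro w
    by_contra hw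
    have := mem_of_wordCoeff_ne_zero hf hw
    simp only [Finset.mem_insert, Finset.mem_singleton] at this
    obtain ⟨h1, h2, h3, h4, h5, h6⟩ := h
    rcases this with rfl | rfl | rfl | rfl | rfl | rfl <;> contradiction
  refine FreeAlgebra.equivMonoidAlgebraFreeMonoid.injective ?_
  rw [map_zero]
  ext w
  exact h0 (FreeMonoid.toList w)

theorem mem_image_iff {f : NCPoly 3} (hf : IsMultilinear f) {m : ℕ}
    (A : Matrix (Fin m) (Fin m) ℂ) :
    A ∈ image f m ↔ ∃ X Y Z, triForm (wordCoeff f [0, 1, 2]) (wordCoeff f [0, 2, 1])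
      (wordCoeff f [1, 0, 2]) (wordCoeff f [1, 2, 0]) (wordCoeff f [2, 0, 1])
      (wordCoeff f [2, 1, 0]) X Y Z = A := by
  constructor
  · rintro ⟨X, rfl⟩
    exact ⟨X 0, X 1, X 2, (eval_eq_triForm hf X).symm⟩
  · rintro ⟨X, Y, Z, rfl⟩
    exact ⟨![X, Y, Z], eval_eq_triForm hf _⟩

/-! ### Determination of the images -/

theorem image_eq_univ_of_add_ne_zero {f : NCPoly 3} (hf : IsMultilinear f)
    (h : evenSum f + oddSum f ≠ 0) (m : ℕ) : image f m = Set.univ := by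
  refine Set.eq_univ_of_forall fun A => (mem_image_iff hf A).2
    ⟨1, 1, (evenSum f + oddSum f)⁻¹ • A, ?_⟩
  simp only [triForm, one_mul, mul_one, ← add_smul, smul_smul]
  rw [evenSum, oddSum] at *
  convert one_smul ℂ A using 2
  field_simp
  ring

theorem image_zero (m : ℕ) : image (0 : NCPoly 3) m = {0} := by
  simp [image, eval]

theorem image_one_eq_singleton {f : NCPoly 3} (hf : IsMultilinear f)
    (h : evenSum f + oddSum f = 0) : image f 1 = {0} := by
  have hcomm : ∀ A B : Matrix (Fin 1) (Fin 1) ℂ, A * B = B * A := by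
    intro A B
    ext i j
    simp [mul_apply, Subsingleton.elim i 0, Subsingleton.elim j 0, mul_comm]
  refine Set.eq_singleton_iff_unique_mem.2 ⟨⟨0, ?_⟩, fun A hA => ?_⟩
  · simp [eval_eq_triForm hf, triForm]
  · obtain ⟨X, Y, Z, rfl⟩ := (mem_image_iff hf A).1 hA
    -- All six words agree for commuting matrices, so the value is `(α + β) XYZ`.
    have h1 : X * Z * Y = X * Y * Z := by rw [mul_assoc, hcomm Z, mul_assoc]
    have h2 : Y * X * Z = X * Y * Z := by rw [hcomm Y]
    have h3 : Y * Z * X = X * Y * Z := by rw [hcomm, mul_assoc]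
    have h4 : Z * X * Y = X * Y * Z := by rw [mul_assoc, hcomm]
    have h5 : Z * Y * X = X * Y * Z := by rw [hcomm Z, h3]
    simp only [triForm, h1, h2, h3, h4, h5, ← add_smul]
    rw [evenSum, oddSum] at h
    convert zero_smul ℂ (X * Y * Z) using 2
    linear_combination h

theorem image_eq_traceless {f : NCPoly 3} (hf : IsMultilinear f) (hf0 : f ≠ 0)
    (h₁ : evenSum f = 0) (h₂ : oddSum f = 0) (k : ℕ) :
    image f (k + 2) = (traceless (k + 2) : Set (Matrix (Fin (k + 2)) (Fin (k + 2)) ℂ)) := by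
  ext A
  rw [mem_image_iff hf]
  simp only [traceless, SetLike.mem_coe, LinearMap.mem_ker, traceLinearMap_apply]
  constructor
  · rintro ⟨X, Y, Z, rfl⟩
    rw [trace_triForm]
    rw [evenSum] at h₁
    rw [oddSum] at h₂
    rw [h₁, h₂]
    simp
  · intro hA
    by_cases hs : ∃ x : ℂ, A = scalar _ x
    · obtain ⟨x, rfl⟩ := hs
      have hx : x = 0 := by
        rw [scalar_apply, trace_diagonal] at hA
        simpa [show (k : ℂ) + 2 ≠ 0 by exact_mod_cast (show k + 2 ≠ 0 by omega)] using hA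
      exact ⟨0, 0, 0, by simp [triForm, hx]⟩
    · push Not at hs
      exact exists_triForm_eq_of_nonscalar
        (fun h => hf0 (eq_zero_of_wordCoeff_eq_zero hf h)) A hs (Or.inl hA)

theorem image_eq_univ {f : NCPoly 3} (hf : IsMultilinear f)
    (h : evenSum f ≠ 0 ∨ oddSum f ≠ 0) (k : ℕ) : image f (k + 2) = Set.univ := by
  by_cases hs : evenSum f + oddSum f = 0
  · have he : evenSum f ≠ 0 := by
      rcases h with h | h
      · exact h
      · intro h'
        exact h (by simpa [h'] using hs)
    rw [evenSum, oddSum] at hs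
    rw [evenSum] at he
    refine Set.eq_univ_of_forall fun A => (mem_image_iff hf A).2 ?_
    by_cases hA : ∃ x : ℂ, A = scalar _ x
    · obtain ⟨x, rfl⟩ := hA
      exact exists_triForm_eq_scalar he hs x
    · push Not at hA
      refine exists_triForm_eq_of_nonscalar (fun h0 => he ?_) A hA (Or.inr ⟨he, hs⟩)
      simp [h0.1, h0.2.2.2.1, h0.2.2.2.2.1]
  · exact image_eq_univ_of_add_ne_zero hf hs _

theorem traceless_ne_bot (k : ℕ) : traceless (k + 2) ≠ ⊥ := by
  intro h
  have hm : single (0 : Fin (k + 2)) 1 (1 : ℂ) ∈ traceless (k + 2) := by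
    simp [traceless]
  rw [h, Submodule.mem_bot] at hm
  simpa using congrFun (congrFun hm 0) 1

theorem traceless_ne_top (k : ℕ) : traceless (k + 2) ≠ ⊤ := by
  intro h
  have hm : single (0 : Fin (k + 2)) 0 (1 : ℂ) ∈ traceless (k + 2) := by simp [h]
  simp [traceless] at hm

end KaplanskyLvov

open KaplanskyLvov in
theorem theorem1p2 (f : NCPoly 3) (hf : IsMultilinear f) (d : ℕ) (hd : 0 < d)
    (hcase : Even d ∨ (Odd d ∧ d < 17)) :
    ∃ V : Submodule ℂ (Matrix (Fin d) (Fin d) ℂ),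
      image f d = (V : Set (Matrix (Fin d) (Fin d) ℂ)) ∧
      (V = ⊥ ∨ V = traceless d ∨ V = ⊤) ∧
      (d = 1 →
        (V = ⊥ ↔ evenSum f + oddSum f = 0) ∧
        (V = ⊤ ↔ evenSum f + oddSum f ≠ 0)) ∧
      (2 ≤ d →
        (V = ⊥ ↔ f = 0) ∧
        (V = traceless d ↔ f ≠ 0 ∧ evenSum f = 0 ∧ oddSum f = 0) ∧
        (V = ⊤ ↔ evenSum f ≠ 0 ∨ oddSum f ≠ 0)) := by
  rcases d with _ | _ | k
  · exact absurd hd (lt_irrefl 0)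
  · by_cases h : evenSum f + oddSum f = 0
    · exact ⟨⊥, by simpa using image_one_eq_singleton hf h, Or.inl rfl,
        fun _ => by simp [h, bot_ne_top], fun h' => by omega⟩
    · exact ⟨⊤, by simpa using image_eq_univ_of_add_ne_zero hf h 1, Or.inr (Or.inr rfl),
        fun _ => by simp [h, top_ne_bot], fun h' => by omega⟩
  · by_cases h0 : f = 0
    · subst h0
      have he : evenSum 0 = 0 := by simp [evenSum, wordCoeff]
      have ho : oddSum 0 = 0 := by simp [oddSum, wordCoeff]
      exact ⟨⊥, by simpa using image_zero (k + 2), Or.inl rfl, fun h' => by omega,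
        fun _ => by simp [he, ho, bot_ne_top, (traceless_ne_bot k).symm]⟩
    · by_cases h : evenSum f = 0 ∧ oddSum f = 0
      · exact ⟨traceless (k + 2), image_eq_traceless hf h0 h.1 h.2 k, Or.inr (Or.inl rfl),
          fun h' => by omega,
          fun _ => by simp [h0, h, traceless_ne_bot k, traceless_ne_top k]⟩
      · have h' : evenSum f ≠ 0 ∨ oddSum f ≠ 0 := not_and_or.1 h
        exact ⟨⊤, by simpa using image_eq_univ hf h' k, Or.inr (Or.inr rfl),
          fun h' => by omega,
          fun _ => by simp [h0, h, h', top_ne_bot, (traceless_ne_top k).symm]⟩
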